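/- Let $s\ge\frac12$. For $\psi\in L^2(\mathbb R,\mathbb C)$ let $\hat\psi(\xi)=\frac1{\sqrt{2\pi}}\int\psi(y)e^{-iy\xi}\,dy$ be its Fourier transform, let $H^s=H^s(\mathbb R,\mathbb C)$ be the space of those $\psi\in L^2$ with $|\xi|^s\hat\psi\in L^2$, let $D^s\psi$ be the function with Fourier transform $|\xi|^s\hat\psi(\xi)$, and let $\|\psi\|^2=\|D^s\psi\|_{L^2}^2+\|\psi\|_{L^2}^2$ be the norm of $H^s$. Let $W:\mathbb C\to\mathbb R$ be of the form $W(\psi)=F(|\psi|)$ with $F\in C^2([0,\infty),\mathbb R)$. Put $E_0=\frac12F''(0)$ and write $F(r)=E_0r^2+N(r)$ for $r\ge 0$. Assume that $E_0>0$ and that * (W-0) $F(0)=F'(0)=0$; * (W-1) there is $r_0>0$ with $N(r_0)<0$; * (W-2) there are $2<q_1\le q_2<\infty$ and $c_1$ with $|N'(r)|\le c_1\left(r^{q_1-1}+r^{q_2-1}\right)$ for all $r\ge0$; * (W-3) there are $p\in(2,4s+2)$ and $c\ge0$ with $N(r)\ge-c\,r^p$ for all sufficiently large $r$. Then for every $\psi\in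 H^s$ the function $\frac12|D^s\psi|^2+W(\psi)$ is integrable, so that $$E(\psi)=\int_{\mathbb R}\Big(\tfrac12|D^s\psi|^2+W(\psi)\Big)dx,\qquad C(\psi)=\int_{\mathbb R}|\psi|^2\,dx$$ are well-defined real functionals on $H^s$, and they satisfy the coercivity assumption (EC-3): for $\psi\in H^s$ one has $C(\psi)>0$ if and only if $\psi\ne0$, and there exist $a\ge0$ and $\beta>1$ such that * (i) $E(\psi)+aC(\psi)^\beta\ge0$ for all $\psi\in H^s$; * (ii) $E(\psi)+aC(\psi)^\beta\to\infty$ as $\|\psi\|\to\infty$; * (iii) every bounded sequence $(\psi_n)$ in $H^s$ with $E(\psi_n)+aC(\psi_n)^\beta\to0$ satisfies $\psi_n\to0$ in $H^s$. -/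

import Mathlib

open MeasureTheory Filter Topology FourierTransform

noncomputable section

namespace FracSchrodinger

/-- The complex Hilbert space `L²(ℝ, ℂ)`. -/
abbrev L2 : Type := Lp (α := ℝ) ℂ 2 (volume : Measure ℝ)

/-- The symbol of `D^s`, i.e. `|ξ|^s` in the angular frequency `ξ`. Mathlib's Fourier transform
`𝓕 u η = ∫ u y * exp (-2πi y η) dy` uses the frequency `η = ξ / (2π)`, so that `|ξ| = |2πη|`. -/
def symbol (s : ℝ) (η : ℝ) : ℝ := |2 * Real.pi * η| ^ s

/-- The functions `u ∈ L²` for which `|ξ|^s û(ξ)` is square integrable. -/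
def sobolevSubmodule (s : ℝ) : Submodule ℂ L2 where
  carrier := {u | MemLp (fun η : ℝ => (symbol s η : ℂ) * (𝓕 u : L2) η) 2 volume}
  zero_mem' := by
    have h0 : (𝓕 (0 : L2) : L2) = 0 := (Lp.fourierTransformₗᵢ ℝ ℂ).map_zero
    have h : (fun η : ℝ => (symbol s η : ℂ) * (𝓕 (0 : L2) : L2) η) =ᵐ[volume] 0 := by
      rw [h0]
      filter_upwards [Lp.coeFn_zero ℂ 2 (volume : Measure ℝ)] with η hη
      rw [hη, Pi.zero_apply, mul_zero]
    exact (memLp_congr_ae h).2 MemLp.zero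
  add_mem' := by
    intro u v hu hv
    have hF : (𝓕 (u + v) : L2) = (𝓕 u : L2) + (𝓕 v : L2) :=
      (Lp.fourierTransformₗᵢ ℝ ℂ).map_add u v
    have h : (fun η : ℝ => (symbol s η : ℂ) * (𝓕 (u + v) : L2) η) =ᵐ[volume]
        (fun η : ℝ => (symbol s η : ℂ) * (𝓕 u : L2) η) +
          (fun η : ℝ => (symbol s η : ℂ) * (𝓕 v : L2) η) := by
      rw [hF]
      filter_upwards [Lp.coeFn_add (𝓕 u : L2) (𝓕 v : L2)] with η hη
      rw [Pi.add_apply, hη, Pi.add_apply, mul_add]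
    exact (memLp_congr_ae h).2 (MemLp.add hu hv)
  smul_mem' := by
    intro c u hu
    have hF : (𝓕 (c • u) : L2) = c • (𝓕 u : L2) :=
      (Lp.fourierTransformₗᵢ ℝ ℂ).map_smul c u
    have h : (fun η : ℝ => (symbol s η : ℂ) * (𝓕 (c • u) : L2) η) =ᵐ[volume]
        c • (fun η : ℝ => (symbol s η : ℂ) * (𝓕 u : L2) η) := by
      rw [hF]
      filter_upwards [Lp.coeFn_smul c (𝓕 u : L2)] with η hη
      simp only [hη, Pi.smul_apply, smul_eq_mul]
      ring
    exact (memLp_congr_ae h).2 (MemLp.const_smul hu c)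

/-- The Sobolev space `H^s = H^s(ℝ, ℂ)`. It is a type of its own, since its norm is not the one
inherited from `L²`. -/
def HSpace (s : ℝ) : Type := sobolevSubmodule s

namespace HSpace

variable {s : ℝ}

instance : AddCommGroup (HSpace s) := inferInstanceAs (AddCommGroup (sobolevSubmodule s))

instance : Module ℂ (HSpace s) := inferInstanceAs (Module ℂ (sobolevSubmodule s))

/-- The inclusion `H^s ⊆ L²`. -/
def toL2 : HSpace s →ₗ[ℂ] L2 := (sobolevSubmodule s).subtype

theorem memLp_weighted (u : HSpace s) :
    MemLp (fun η : ℝ => (symbol s η : ℂ) * (𝓕 (toL2 u) : L2) η) 2 volume := u.2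

/-- `ξ ↦ |ξ|^s û(ξ)` as an element of `L²`. -/
def weightedFourier : HSpace s →ₗ[ℂ] L2 where
  toFun u := MemLp.toLp (fun η : ℝ => (symbol s η : ℂ) * (𝓕 (toL2 u) : L2) η) (memLp_weighted u)
  map_add' := by
    intro u v
    have hF : (𝓕 (toL2 (u + v)) : L2) = (𝓕 (toL2 u) : L2) + (𝓕 (toL2 v) : L2) := by
      rw [map_add]
      exact (Lp.fourierTransformₗᵢ ℝ ℂ).map_add _ _
    refine Eq.trans (MemLp.toLp_congr _ ((memLp_weighted u).add (memLp_weighted v)) ?_)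
      (MemLp.toLp_add _ _)
    rw [hF]
    filter_upwards [Lp.coeFn_add (𝓕 (toL2 u) : L2) (𝓕 (toL2 v) : L2)] with η hη
    rw [Pi.add_apply, hη, Pi.add_apply, mul_add]
  map_smul' := by
    intro c u
    have hF : (𝓕 (toL2 (c • u)) : L2) = c • (𝓕 (toL2 u) : L2) := by
      rw [map_smul]
      exact (Lp.fourierTransformₗᵢ ℝ ℂ).map_smul _ _
    refine Eq.trans (MemLp.toLp_congr _ ((memLp_weighted u).const_smul c) ?_)
      (MemLp.toLp_const_smul c _)
    rw [hF]
    filter_upwards [Lp.coeFn_smul c (𝓕 (toL2 u) : L2)] with η hη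
    simp only [hη, Pi.smul_apply, smul_eq_mul]
    ring

/-- The operator `D^s : H^s → L²`, i.e. the Fourier multiplier with symbol `|ξ|^s`. -/
def fracD : HSpace s →ₗ[ℂ] L2 :=
  (Lp.fourierTransformₗᵢ ℝ ℂ).symm.toLinearEquiv.toLinearMap ∘ₗ weightedFourier

/-- The map `u ↦ (D^s u, u)` into the Hilbert space `L² ⊕ L²`. -/
def graphMap : HSpace s →ₗ[ℂ] WithLp 2 (L2 × L2) :=
  (WithLp.linearEquiv 2 ℂ (L2 × L2)).symm.toLinearMap ∘ₗ (LinearMap.prod fracD toL2)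

theorem graphMap_injective : Function.Injective (graphMap (s := s)) := by
  intro u v h
  have h2 : toL2 u = toL2 v := congrArg (fun w : WithLp 2 (L2 × L2) => w.snd) h
  exact Subtype.ext h2

/-- The norm of `H^s`, given by `‖u‖² = ‖D^s u‖²_{L²} + ‖u‖²_{L²}`. -/
instance : NormedAddCommGroup (HSpace s) :=
  NormedAddCommGroup.induced (HSpace s) (WithLp 2 (L2 × L2)) graphMap graphMap_injective

theorem norm_sq_eq (u : HSpace s) : ‖u‖ ^ 2 = ‖fracD u‖ ^ 2 + ‖toL2 u‖ ^ 2 :=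
  WithLp.prod_norm_sq_eq_of_L2 (graphMap u)

end HSpace

/-- The energy density `½|D^s ψ|² + W(ψ)`. -/
def energyDensity (s : ℝ) (W : ℂ → ℝ) (ψ : HSpace s) (x : ℝ) : ℝ :=
  (1 / 2) * ‖HSpace.fracD ψ x‖ ^ 2 + W (HSpace.toL2 ψ x)

/-- The energy `E(ψ) = ∫ (½|D^s ψ|² + W(ψ)) dx`. -/
def energy (s : ℝ) (W : ℂ → ℝ) (ψ : HSpace s) : ℝ := ∫ x, energyDensity s W ψ x

/-- The charge `C(ψ) = ∫ |ψ|² dx`. -/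
def charge (s : ℝ) (ψ : HSpace s) : ℝ := ∫ x, ‖HSpace.toL2 ψ x‖ ^ 2

/-- The coercivity assumption on the energy `E` and the charge `C`. -/
def Coercivity {X : Type*} [NormedAddCommGroup X] (E C : X → ℝ) : Prop :=
  (∀ u : X, 0 < C u ↔ u ≠ 0) ∧
  ∃ a β : ℝ, 0 ≤ a ∧ 1 < β ∧
    (∀ u : X, 0 ≤ E u + a * C u ^ β) ∧
    Tendsto (fun u : X => E u + a * C u ^ β) (comap (fun u : X => ‖u‖) atTop) atTop ∧
    ∀ u : ℕ → X, (∃ M : ℝ, ∀ n, ‖u n‖ ≤ M) →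
      Tendsto (fun n => E (u n) + a * C (u n) ^ β) atTop (𝓝 0) → Tendsto u atTop (𝓝 0)

/-- `E₀ = ½ F''(0)` for a function `F` on `[0, ∞)`. -/
def quadCoeff (F : ℝ → ℝ) : ℝ := (1 / 2) * iteratedDerivWithin 2 F (Set.Ici 0) 0

/-- The remainder `N` in `F(r) = E₀ r² + N(r)`, `r ≥ 0`. -/
def remainder (F : ℝ → ℝ) (r : ℝ) : ℝ := F r - quadCoeff F * r ^ 2

end FracSchrodinger

end

/-! Everything reduces to `E + a C^β ≥ k ‖ψ‖²` with `k > 0`, which yields (i)–(iii) at once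
(`coercivity_of_le`). Since `N = o(r²)` at `0` and `N ≥ -c r^p` at infinity, `W(ψ) ≥ (E₀/2)|ψ|² -
A|ψ|^p` (`exists_remainder_lower_bound`), so the task is to absorb `∫|ψ|^p` into a small multiple of
`‖D^s ψ‖²` plus a power of the charge.

The `L^p` bounds come from the layer-cake formula with a frequency cutoff depending on the level
`t`: the cutoff is such that low frequencies contribute at most `t/2` pointwise, and Chebyshev and
Plancherel handle the rest. Integrating in `t` bounds `∫|u|^p` by a weighted integral of `|û|²`
(`lintegral_norm_rpow_le`). With the plain `L²` bound on low frequencies the weight is of order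
`‖u‖^(p-2) |η|^((p-2)/2)`; its exponent is below `2s` exactly when `p < 4s + 2`, and Young's
inequality then applies pointwise in `η`. A flatter weight gives finiteness for every `p > 2`, hence
integrability of `W(ψ)`. -/

namespace FracSchrodinger

open scoped ENNReal

/-! ### Fourier inversion on `L²` and level sets -/

theorem fourierInv_coeFn_ae_eq (g : L2) (hg : Integrable g volume) :
    (𝓕⁻ g : L2) =ᵐ[volume] 𝓕⁻ (g : ℝ → ℂ) := by
  have hcont : Continuous (𝓕⁻ (g : ℝ → ℂ)) :=
    VectorFourier.fourierIntegral_continuous Real.continuous_fourierChar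
      (by exact (continuous_inner (𝕜 := ℝ) (E := ℝ)).neg) hg
  -- Both sides are compared by pairing with test functions: for the `L²` transform this is the
  -- distributional definition, for the integral it is Fubini.
  refine ae_eq_of_integral_contDiff_smul_eq
    ((Lp.memLp (𝓕⁻ g : L2)).locallyIntegrable (by norm_num)) hcont.locallyIntegrable ?_
  intro φ hφ hφc
  have h₁ : HasCompactSupport (Complex.ofRealCLM ∘ φ) := hφc.comp_left rfl
  have h₂ : ContDiff ℝ _ (Complex.ofRealCLM ∘ φ) := Complex.ofRealCLM.contDiff.comp hφ
  set Φ := h₁.toSchwartzMap h₂ with hΦ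
  have hΦx : ∀ x, Φ x = (φ x : ℂ) := fun x => rfl
  have e1 : ∫ x, φ x • (𝓕⁻ g : L2) x = ∫ x, Φ x • (𝓕⁻ g : L2) x :=
    integral_congr_ae (.of_forall fun x => by simp [hΦx])
  have e2 : ∫ x, φ x • 𝓕⁻ (g : ℝ → ℂ) x = ∫ x, Φ x • 𝓕⁻ (g : ℝ → ℂ) x :=
    integral_congr_ae (.of_forall fun x => by simp [hΦx])
  rw [e1, e2, ← Lp.toTemperedDistribution_apply, ← Lp.fourierInv_toTemperedDistribution_eq,
    TemperedDistribution.fourierInv_apply, Lp.toTemperedDistribution_apply,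
    SchwartzMap.fourierInv_coe]
  have hflip : (-innerₗ ℝ : ℝ →ₗ[ℝ] ℝ →ₗ[ℝ] ℝ).flip = -innerₗ ℝ := by
    ext; simp
  have := VectorFourier.integral_fourierIntegral_smul_eq_flip (L := -innerₗ ℝ)
    (μ := volume) (ν := volume)
    Real.continuous_fourierChar
    (by exact (continuous_inner (𝕜 := ℝ) (E := ℝ)).neg) (Φ.integrable (μ := volume)) hg
  rw [hflip] at this
  exact this

theorem enorm_fourierInv_le (g : L2) (hg : Integrable g volume) :
    ∀ᵐ x, ‖(𝓕⁻ g : L2) x‖ₑ ≤ ∫⁻ η, ‖g η‖ₑ := by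
  filter_upwards [fourierInv_coeFn_ae_eq g hg] with x hx
  rw [hx, Real.fourierInv_eq]
  refine (enorm_integral_le_lintegral_enorm _).trans (lintegral_mono fun η => ?_)
  rw [Circle.smul_def, smul_eq_mul, enorm_mul, ← ofReal_norm, Circle.norm_coe]
  simp

theorem lintegral_enorm_sq (f : L2) : ∫⁻ x, ‖f x‖ₑ ^ 2 = ENNReal.ofReal (‖f‖ ^ 2) := by
  have h := Lp.enorm_def f
  rw [eLpNorm_eq_lintegral_rpow_enorm_toReal (by norm_num) (by norm_num)] at h
  simp only [ENNReal.toReal_ofNat, ENNReal.rpow_ofNat] at h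
  rw [ENNReal.ofReal_pow (norm_nonneg _), ofReal_norm, h, ← ENNReal.rpow_ofNat,
    ← ENNReal.rpow_mul]
  norm_num

/-- Chebyshev's inequality for the high frequency part: if the frequencies below `A` contribute
at most `t / 2` to the supremum, then the level set `{t < ‖u‖}` is controlled by the others. -/
theorem meas_lt_norm_mul_sq_le (u : L2) {A t : ℝ} (ht : 0 < t)
    (h : ∫⁻ η in {η : ℝ | |η| < A}, ‖(𝓕 u : L2) η‖ₑ ≤ ENNReal.ofReal (t / 2)) :
    volume {x | t < ‖u x‖} * ENNReal.ofReal (t ^ 2) ≤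
      4 * ∫⁻ η in {η : ℝ | A ≤ |η|}, ‖(𝓕 u : L2) η‖ₑ ^ 2 := by
  set g : L2 := 𝓕 u
  have hS : MeasurableSet {η : ℝ | |η| < A} := measurableSet_lt (by fun_prop) (by fun_prop)
  have hS' : MeasurableSet {η : ℝ | A ≤ |η|} := measurableSet_le (by fun_prop) (by fun_prop)
  have hlow := (Lp.memLp g).indicator hS
  have hhigh := (Lp.memLp g).indicator hS'
  set g₁ : L2 := hlow.toLp _
  set g₂ : L2 := hhigh.toLp _
  have hg₁ : g₁ =ᵐ[volume] Set.indicator {η : ℝ | |η| < A} g := hlow.coeFn_toLp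
  have hg₂ : g₂ =ᵐ[volume] Set.indicator {η : ℝ | A ≤ |η|} g := hhigh.coeFn_toLp
  have hsum : g = g₁ + g₂ := by
    refine Lp.ext ?_
    filter_upwards [hg₁, hg₂, Lp.coeFn_add g₁ g₂] with η h1 h2 h3
    rw [h3, Pi.add_apply, h1, h2]
    by_cases hη : |η| < A
    · simp [hη]
    · simp [hη, not_lt.1 hη]
  have hu : u = (𝓕⁻ g₁ : L2) + 𝓕⁻ g₂ := by
    rw [← FourierTransform.fourierInv_add, ← hsum]
    exact (FourierTransform.fourierInv_fourier_eq u).symm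
  have hL1 : ∫⁻ η, ‖g₁ η‖ₑ ≤ ENNReal.ofReal (t / 2) := by
    refine le_trans (le_of_eq ?_) h
    rw [← lintegral_indicator hS]
    refine lintegral_congr_ae ?_
    filter_upwards [hg₁] with η hη
    rw [hη, enorm_indicator_eq_indicator_enorm]
  have hint : Integrable g₁ volume :=
    ⟨Lp.aestronglyMeasurable _, hL1.trans_lt ENNReal.ofReal_lt_top⟩
  -- Almost everywhere the low part is at most `t/2`, so `t < ‖u‖` forces the high part to be at
  -- least `t/2`.
  have hsub : volume {x | t < ‖u x‖} ≤
      volume {x | ENNReal.ofReal (t ^ 2 / 4) ≤ ‖(𝓕⁻ g₂ : L2) x‖ₑ ^ 2} := by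
    refine measure_mono_ae ?_
    have hadd : u =ᵐ[volume] fun x => (𝓕⁻ g₁ : L2) x + (𝓕⁻ g₂ : L2) x := by
      conv_lhs => rw [hu]
      exact Lp.coeFn_add _ _
    filter_upwards [enorm_fourierInv_le g₁ hint, hadd] with x h1 h2
    intro hx
    have hx : t < ‖u x‖ := hx
    change ENNReal.ofReal (t ^ 2 / 4) ≤ ‖(𝓕⁻ g₂ : L2) x‖ₑ ^ 2
    have h1' : ‖(𝓕⁻ g₁ : L2) x‖ ≤ t / 2 := by
      have := h1.trans hL1
      rwa [← ofReal_norm, ENNReal.ofReal_le_ofReal_iff (by positivity)] at this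
    rw [h2] at hx
    have h3 : t / 2 ≤ ‖(𝓕⁻ g₂ : L2) x‖ := by
      have := norm_add_le ((𝓕⁻ g₁ : L2) x) ((𝓕⁻ g₂ : L2) x)
      linarith
    rw [← ofReal_norm, ← ENNReal.ofReal_pow (norm_nonneg _)]
    refine ENNReal.ofReal_le_ofReal ?_
    nlinarith
  have hcheb := mul_meas_ge_le_lintegral₀ (μ := volume)
    (f := fun x => ‖(𝓕⁻ g₂ : L2) x‖ₑ ^ 2)
    ((Lp.aestronglyMeasurable (𝓕⁻ g₂ : L2)).enorm.pow_const 2) (ENNReal.ofReal (t ^ 2 / 4))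
  have hplan : ∫⁻ x, ‖(𝓕⁻ g₂ : L2) x‖ₑ ^ 2 = ∫⁻ η in {η : ℝ | A ≤ |η|}, ‖g η‖ₑ ^ 2 := by
    have : ‖(𝓕⁻ g₂ : L2)‖ = ‖g₂‖ := (Lp.fourierTransformₗᵢ ℝ ℂ).symm.norm_map g₂
    rw [lintegral_enorm_sq, this, ← lintegral_enorm_sq, ← lintegral_indicator hS']
    refine lintegral_congr_ae ?_
    filter_upwards [hg₂] with η hη
    rw [hη]
    by_cases h' : A ≤ |η| <;> simp [h']
  have h4 : ENNReal.ofReal (t ^ 2) = 4 * ENNReal.ofReal (t ^ 2 / 4) := by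
    rw [show (4 : ℝ≥0∞) = ENNReal.ofReal 4 by simp, ← ENNReal.ofReal_mul (by norm_num)]
    congr 1; ring
  calc volume {x | t < ‖u x‖} * ENNReal.ofReal (t ^ 2)
      = 4 * (ENNReal.ofReal (t ^ 2 / 4) * volume {x | t < ‖u x‖}) := by rw [h4]; ring
    _ ≤ 4 * (ENNReal.ofReal (t ^ 2 / 4) *
        volume {x | ENNReal.ofReal (t ^ 2 / 4) ≤ ‖(𝓕⁻ g₂ : L2) x‖ₑ ^ 2}) := by gcongr
    _ ≤ _ := by rw [← hplan]; gcongr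

/-! ### Power weights and the `L^p` bound -/

theorem lintegral_Ioc_rpow {q b : ℝ} (hq : -1 < q) (hb : 0 ≤ b) :
    ∫⁻ t in Set.Ioc 0 b, ENNReal.ofReal (t ^ q) = ENNReal.ofReal (b ^ (q + 1) / (q + 1)) := by
  have hi : IntervalIntegrable (fun t : ℝ => t ^ q) volume 0 b :=
    intervalIntegral.intervalIntegrable_rpow' hq
  rw [← ofReal_integral_eq_lintegral_ofReal
    ((intervalIntegrable_iff_integrableOn_Ioc_of_le hb).1 hi), ← intervalIntegral.integral_of_le hb,
    integral_rpow (Or.inl hq), Real.zero_rpow (by linarith), sub_zero]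
  filter_upwards [ae_restrict_mem measurableSet_Ioc] with t ht
  exact Real.rpow_nonneg ht.1.le _

theorem lintegral_abs_lt_rpow {q A : ℝ} (hq : -1 < q) (hA : 0 ≤ A) :
    ∫⁻ η in {η : ℝ | |η| < A}, ENNReal.ofReal (|η| ^ q) =
      ENNReal.ofReal (2 * (A ^ (q + 1) / (q + 1))) := by
  have hS : {η : ℝ | |η| < A} = Set.Ioo (-A) A := by ext; simp [abs_lt]
  rw [hS]
  have hsplit : Set.Ioo (-A) A =ᵐ[volume] (Set.Ioc (-A) 0 ∪ Set.Ioc 0 A : Set ℝ) := by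
    rw [Set.Ioc_union_Ioc_eq_Ioc (by linarith) hA]
    exact Ioo_ae_eq_Ioc
  rw [setLIntegral_congr hsplit, lintegral_union measurableSet_Ioc
    (Set.Ioc_disjoint_Ioc_of_le le_rfl)]
  have e1 : ∫⁻ η in Set.Ioc 0 A, ENNReal.ofReal (|η| ^ q) =
      ENNReal.ofReal (A ^ (q + 1) / (q + 1)) := by
    rw [← lintegral_Ioc_rpow hq hA]
    refine setLIntegral_congr_fun measurableSet_Ioc fun η hη => ?_
    simp only [abs_of_pos hη.1]
  have e2 : ∫⁻ η in Set.Ioc (-A) 0, ENNReal.ofReal (|η| ^ q) =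
      ∫⁻ η in Set.Ioc 0 A, ENNReal.ofReal (|η| ^ q) := by
    have hmp := Measure.measurePreserving_neg (volume : Measure ℝ)
    rw [← hmp.setLIntegral_comp_preimage_emb (MeasurableEquiv.neg ℝ).measurableEmbedding]
    simp only [abs_neg]
    refine setLIntegral_congr ?_
    simp only [Set.neg_preimage, Set.neg_Ioc, neg_neg, neg_zero]
    exact Ico_ae_eq_Ioc.trans (by rfl)
  rw [e2, e1, two_mul, ENNReal.ofReal_add] <;>
  exact div_nonneg (Real.rpow_nonneg hA _) (by linarith)

theorem lintegral_norm_rpow_le (u : L2) {γ M p : ℝ} (hγ : 0 < γ) (hM : 0 < M) (hp : 2 < p)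
    (h : ∀ A : ℝ, 0 < A → ∫⁻ η in {η : ℝ | |η| < A}, ‖(𝓕 u : L2) η‖ₑ ≤
      ENNReal.ofReal (M * A ^ γ)) :
    ∫⁻ x, ENNReal.ofReal (‖u x‖ ^ p) ≤
      ∫⁻ η, ENNReal.ofReal (4 * p / (p - 2) * (2 * M * |η| ^ γ) ^ (p - 2)) *
        ‖(𝓕 u : L2) η‖ₑ ^ 2 := by
  set g : L2 := 𝓕 u
  have hgm : Measurable fun η => ‖g η‖ₑ ^ 2 :=
    ((Lp.stronglyMeasurable g).measurable.enorm).pow_const 2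
  have hum : Measurable fun x => ‖u x‖ := (Lp.stronglyMeasurable u).measurable.norm
  have hp0 : 0 < p - 2 := by linarith
  have hlevel : ∀ t ∈ Set.Ioi (0 : ℝ), volume {x | t < ‖u x‖} * ENNReal.ofReal (t ^ (p - 1)) ≤
      4 * ∫⁻ η, ‖g η‖ₑ ^ 2 *
        (Set.Iic (2 * M * |η| ^ γ)).indicator (fun t => ENNReal.ofReal (t ^ (p - 3))) t := by
    intro t ht
    have ht : 0 < t := ht
    -- The cutoff solves `M * A ^ γ = t / 2`.
    set A : ℝ := (t / (2 * M)) ^ γ⁻¹ with hA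
    have hApos : 0 < A := by positivity
    have hAγ : A ^ γ = t / (2 * M) := Real.rpow_inv_rpow (by positivity) hγ.ne'
    have h1 := meas_lt_norm_mul_sq_le u ht (A := A) ((h A hApos).trans
      (ENNReal.ofReal_le_ofReal (by rw [hAγ]; field_simp; rfl)))
    have hsplit : t ^ (p - 1) = t ^ 2 * t ^ (p - 3) := by
      rw [← Real.rpow_natCast, ← Real.rpow_add ht]; congr 1; push_cast; ring
    have hS' : MeasurableSet {η : ℝ | A ≤ |η|} := measurableSet_le (by fun_prop) (by fun_prop)
    rw [hsplit, ENNReal.ofReal_mul (by positivity), ← mul_assoc]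
    refine (mul_le_mul_left h1 _).trans (le_of_eq ?_)
    rw [mul_assoc, ← lintegral_mul_const _ hgm, ← lintegral_indicator hS']
    congr 1
    refine lintegral_congr fun η => ?_
    have hiff : A ≤ |η| ↔ t ≤ 2 * M * |η| ^ γ := by
      rw [← Real.rpow_le_rpow_iff hApos.le (abs_nonneg η) hγ, hAγ, div_le_iff₀' (by positivity)]
    by_cases hη : A ≤ |η|
    · simp [hη, hiff.1 hη]
    · simp [hη, mt hiff.2 hη]
  have hjm : Measurable fun z : ℝ × ℝ => ‖g z.2‖ₑ ^ 2 *
      (Set.Iic (2 * M * |z.2| ^ γ)).indicator (fun t => ENNReal.ofReal (t ^ (p - 3))) z.1 := by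
    refine (hgm.comp measurable_snd).mul ?_
    have : (fun z : ℝ × ℝ => (Set.Iic (2 * M * |z.2| ^ γ)).indicator
        (fun t => ENNReal.ofReal (t ^ (p - 3))) z.1) =
        Set.indicator {z : ℝ × ℝ | z.1 ≤ 2 * M * |z.2| ^ γ}
          (fun z => ENNReal.ofReal (z.1 ^ (p - 3))) := by
      ext z; simp [Set.indicator]
    rw [this]
    refine Measurable.indicator (by fun_prop) (measurableSet_le (by fun_prop) ?_)
    exact ((measurable_snd.norm.pow_const γ).const_mul _)
  rw [lintegral_rpow_eq_lintegral_meas_lt_mul _ (.of_forall fun x => norm_nonneg _)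
    hum.aemeasurable (by linarith)]
  calc ENNReal.ofReal p * ∫⁻ t in Set.Ioi 0, volume {x | t < ‖u x‖} * ENNReal.ofReal (t ^ (p - 1))
      ≤ ENNReal.ofReal p * ∫⁻ t in Set.Ioi (0 : ℝ), 4 * ∫⁻ η, ‖g η‖ₑ ^ 2 *
        (Set.Iic (2 * M * |η| ^ γ)).indicator (fun t => ENNReal.ofReal (t ^ (p - 3))) t := by
        gcongr 1
        exact setLIntegral_mono' measurableSet_Ioi hlevel
    _ = ENNReal.ofReal p * (4 * ∫⁻ η, ‖g η‖ₑ ^ 2 *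
        ENNReal.ofReal ((2 * M * |η| ^ γ) ^ (p - 2) / (p - 2))) := by
        -- Tonelli: for fixed `η` only the levels `0 < t ≤ 2M|η|^γ` remain, and `t ^ (p - 3)` is
        -- integrable at `0` because `p > 2`.
        rw [lintegral_const_mul' _ _ (by norm_num), lintegral_lintegral_swap hjm.aemeasurable]
        congr 2
        refine lintegral_congr fun η => ?_
        have hb : 0 ≤ 2 * M * |η| ^ γ := by positivity
        rw [lintegral_const_mul' _ _ (by simp), lintegral_indicator measurableSet_Iic,
          Measure.restrict_restrict measurableSet_Iic, Set.Iic_inter_Ioi,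
          lintegral_Ioc_rpow (by linarith) hb,
          show p - 3 + 1 = p - 2 by ring]
    _ = _ := by
        rw [← lintegral_const_mul' _ _ (by norm_num), ← lintegral_const_mul' _ _ (by simp)]
        refine lintegral_congr fun η => ?_
        rw [show (4 : ℝ≥0∞) = ENNReal.ofReal 4 by simp, mul_comm (‖g η‖ₑ ^ 2), ← mul_assoc,
          ← mul_assoc, ← ENNReal.ofReal_mul (by linarith), ← ENNReal.ofReal_mul (by linarith)]
        congr 2
        ring

/-- Cauchy–Schwarz with the weights `|η|^(γ - 1/2)` and `|η|^(1/2 - γ)`; the square of the first is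
integrable at `0` because `γ > 0`. -/
theorem setLIntegral_enorm_le (g : L2) {γ B : ℝ} (hγ : 0 < γ) (hB : 0 ≤ B)
    (h : ∫⁻ η, ENNReal.ofReal (|η| ^ (1 - 2 * γ)) * ‖g η‖ₑ ^ 2 ≤ ENNReal.ofReal B)
    {A : ℝ} (hA : 0 < A) :
    ∫⁻ η in {η : ℝ | |η| < A}, ‖g η‖ₑ ≤ ENNReal.ofReal (√(B / γ) * A ^ γ) := by
  have hgm : Measurable fun η => ‖g η‖ₑ := (Lp.stronglyMeasurable g).measurable.enorm
  have hprod : ∀ᵐ η ∂(volume.restrict {η : ℝ | |η| < A}), ‖g η‖ₑ =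
      ((fun η => ENNReal.ofReal (|η| ^ (γ - 1 / 2))) *
        fun η => ENNReal.ofReal (|η| ^ (1 / 2 - γ)) * ‖g η‖ₑ) η := by
    filter_upwards [ae_restrict_of_ae (Measure.ae_ne (volume : Measure ℝ) 0)] with η hη
    have hη : 0 < |η| := abs_pos.2 hη
    rw [Pi.mul_apply, ← mul_assoc, ← ENNReal.ofReal_mul (by positivity), ← Real.rpow_add hη]
    simp
  have hsq : ∀ r a : ℝ, 0 ≤ r → (ENNReal.ofReal (r ^ a)) ^ (2 : ℝ) =
      ENNReal.ofReal (r ^ (2 * a)) := by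
    intro r a hr
    rw [ENNReal.ofReal_rpow_of_nonneg (by positivity) (by norm_num), ← Real.rpow_mul hr, mul_comm]
  have hcs := ENNReal.lintegral_mul_le_Lp_mul_Lq (volume.restrict {η : ℝ | |η| < A})
    Real.HolderConjugate.two_two
    (f := fun η => ENNReal.ofReal (|η| ^ (γ - 1 / 2)))
    (g := fun η => ENNReal.ofReal (|η| ^ (1 / 2 - γ)) * ‖g η‖ₑ)
    (by fun_prop) (by fun_prop)
  rw [lintegral_congr_ae hprod]
  refine hcs.trans ?_
  have e1 : ∫⁻ η in {η : ℝ | |η| < A}, ENNReal.ofReal (|η| ^ (γ - 1 / 2)) ^ (2 : ℝ) =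
      ENNReal.ofReal (A ^ (2 * γ) / γ) := by
    simp_rw [hsq _ _ (abs_nonneg _)]
    rw [lintegral_abs_lt_rpow (by linarith) hA.le]
    congr 1
    rw [show 2 * (γ - 1 / 2) + 1 = 2 * γ by ring]
    field_simp
  have e2 : ∫⁻ η in {η : ℝ | |η| < A}, (ENNReal.ofReal (|η| ^ (1 / 2 - γ)) * ‖g η‖ₑ) ^ (2 : ℝ) ≤
      ENNReal.ofReal B := by
    refine (setLIntegral_le_lintegral _ _).trans (le_trans (le_of_eq ?_) h)
    refine lintegral_congr fun η => ?_
    rw [ENNReal.mul_rpow_of_nonneg _ _ (by norm_num), hsq _ _ (abs_nonneg _), ENNReal.rpow_ofNat]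
    congr 4; ring
  rw [e1]
  calc _ ≤ ENNReal.ofReal (A ^ (2 * γ) / γ) ^ (1 / 2 : ℝ) * ENNReal.ofReal B ^ (1 / 2 : ℝ) := by
        gcongr
    _ = _ := by
        rw [← ENNReal.mul_rpow_of_nonneg _ _ (by norm_num), ← ENNReal.ofReal_mul (by positivity),
          ENNReal.ofReal_rpow_of_nonneg (by positivity) (by norm_num), ← Real.sqrt_eq_rpow]
        congr 1
        have : A ^ (2 * γ) / γ * B = B / γ * (A ^ γ) ^ 2 := by
          rw [← Real.rpow_natCast, ← Real.rpow_mul hA.le, mul_comm γ]; push_cast; ring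
        rw [this, Real.sqrt_mul (by positivity), Real.sqrt_sq (by positivity)]

/-! ### `L^p` estimates on `H^s` -/

namespace HSpace

variable {s : ℝ}

theorem lintegral_symbol_sq (u : HSpace s) :
    ∫⁻ η, ENNReal.ofReal (symbol s η ^ 2) * ‖(𝓕 (toL2 u) : L2) η‖ₑ ^ 2 =
      ENNReal.ofReal (‖fracD u‖ ^ 2) := by
  have h : ‖fracD u‖ = ‖weightedFourier u‖ :=
    (Lp.fourierTransformₗᵢ ℝ ℂ).symm.norm_map (weightedFourier u)
  rw [h, ← lintegral_enorm_sq]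
  refine lintegral_congr_ae ?_
  filter_upwards [(memLp_weighted u).coeFn_toLp] with η hη
  have hη : weightedFourier u η = (symbol s η : ℂ) * (𝓕 (toL2 u) : L2) η := hη
  have hs : 0 ≤ symbol s η := Real.rpow_nonneg (abs_nonneg _) _
  rw [hη, enorm_mul, mul_pow, ← ofReal_norm (symbol s η : ℂ), ← ENNReal.ofReal_pow (norm_nonneg _)]
  congr 3
  simp [abs_of_nonneg hs]

theorem abs_rpow_le_symbol_sq (hs : 0 ≤ s) (η : ℝ) : |η| ^ (2 * s) ≤ symbol s η ^ 2 := by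
  have h : |η| ≤ |2 * Real.pi * η| := by
    rw [abs_mul, abs_of_pos Real.two_pi_pos]
    nlinarith [abs_nonneg η, Real.pi_gt_three]
  rw [symbol, ← Real.rpow_natCast, ← Real.rpow_mul (abs_nonneg _), mul_comm s]
  exact Real.rpow_le_rpow (abs_nonneg _) h (by positivity)

theorem lintegral_enorm_fourier_sq (u : HSpace s) :
    ∫⁻ η, ‖(𝓕 (toL2 u) : L2) η‖ₑ ^ 2 = ENNReal.ofReal (‖toL2 u‖ ^ 2) := by
  rw [lintegral_enorm_sq, Lp.norm_fourier_eq]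

/-- A weight dominated by `b * |ξ|^{2s} + c` integrates accordingly against `|û|²`. -/
theorem lintegral_weight_le (u : HSpace s) {w : ℝ → ℝ} {b c : ℝ} (hb : 0 ≤ b) (hc : 0 ≤ c)
    (hw : ∀ η, w η ≤ b * symbol s η ^ 2 + c) :
    ∫⁻ η, ENNReal.ofReal (w η) * ‖(𝓕 (toL2 u) : L2) η‖ₑ ^ 2 ≤
      ENNReal.ofReal (b * ‖fracD u‖ ^ 2 + c * ‖toL2 u‖ ^ 2) := by
  have hgm : Measurable fun η => ‖(𝓕 (toL2 u) : L2) η‖ₑ ^ 2 :=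
    ((Lp.stronglyMeasurable _).measurable.enorm).pow_const 2
  calc _ ≤ ∫⁻ η, (ENNReal.ofReal b * (ENNReal.ofReal (symbol s η ^ 2) *
          ‖(𝓕 (toL2 u) : L2) η‖ₑ ^ 2) + ENNReal.ofReal c * ‖(𝓕 (toL2 u) : L2) η‖ₑ ^ 2) := by
        refine lintegral_mono fun η => ?_
        rw [← mul_assoc, ← add_mul, ← ENNReal.ofReal_mul hb,
          ← ENNReal.ofReal_add (by positivity) hc]
        gcongr
        exact hw η
    _ = _ := by
        rw [lintegral_add_right _ (hgm.const_mul _), lintegral_const_mul' _ _ (by simp),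
          lintegral_const_mul' _ _ (by simp), lintegral_symbol_sq, lintegral_enorm_fourier_sq,
          ← ENNReal.ofReal_mul hb, ← ENNReal.ofReal_mul hc,
          ← ENNReal.ofReal_add (by positivity) (by positivity)]

theorem abs_rpow_le (hs : 0 ≤ s) {a : ℝ} (ha : 0 ≤ a) (has : a ≤ 2 * s) (η : ℝ) :
    |η| ^ a ≤ 1 * symbol s η ^ 2 + 1 := by
  have h := abs_rpow_le_symbol_sq hs η
  rcases le_total |η| 1 with h1 | h1
  · have := Real.rpow_le_one (abs_nonneg η) h1 ha
    nlinarith [sq_nonneg (symbol s η)]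
  · have := Real.rpow_le_rpow_of_exponent_le h1 has
    linarith

/-- No upper limit on `p` is needed, even at the endpoint `s = 1/2`: this covers the exponents `q₁`,
`q₂`. -/
theorem lintegral_norm_rpow_lt_top (hs : 1 / 2 ≤ s) (u : HSpace s) {p : ℝ} (hp : 2 < p) :
    ∫⁻ x, ENNReal.ofReal (‖toL2 u x‖ ^ p) < ∞ := by
  -- The two weights `|η|^(1 - 2γ)` and `|η|^(γ(p - 2))` must both have exponents in `[0, 1] ⊆ [0,
  -- 2s]`.
  obtain ⟨γ, hγ, hγ2, hγp⟩ : ∃ γ : ℝ, 0 < γ ∧ γ ≤ 1 / 2 ∧ γ * (p - 2) ≤ 1 := by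
    have hp0 : 0 < p - 2 := by linarith
    refine ⟨min (1 / 2) (1 / (p - 2)), by positivity, min_le_left _ _, ?_⟩
    calc _ ≤ 1 / (p - 2) * (p - 2) := by gcongr; exact min_le_right _ _
      _ = 1 := by field_simp
  -- The extra `1` keeps `B`, hence `M`, positive when `u = 0`.
  set B : ℝ := 1 * ‖fracD u‖ ^ 2 + 1 * ‖toL2 u‖ ^ 2 + 1 with hB
  have hBpos : 0 < B := by positivity
  have hweight : ∫⁻ η, ENNReal.ofReal (|η| ^ (1 - 2 * γ)) * ‖(𝓕 (toL2 u) : L2) η‖ₑ ^ 2 ≤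
      ENNReal.ofReal B :=
    (lintegral_weight_le u zero_le_one zero_le_one
      (abs_rpow_le (by linarith) (by linarith) (by linarith))).trans
      (ENNReal.ofReal_le_ofReal (by rw [hB]; linarith))
  have hM : 0 < √(B / γ) := by positivity
  refine (lintegral_norm_rpow_le (toL2 u) hγ hM hp
    fun A hA => setLIntegral_enorm_le _ hγ hBpos.le hweight hA).trans_lt ?_
  have hp0 : 0 < p - 2 := by linarith
  set K : ℝ := 4 * p / (p - 2) * (2 * √(B / γ)) ^ (p - 2) with hK
  have hKpos : 0 < K := by positivity
  refine (lintegral_weight_le u hKpos.le hKpos.le fun η => ?_).trans_lt ENNReal.ofReal_lt_top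
  rw [Real.mul_rpow (by positivity) (by positivity), ← Real.rpow_mul (abs_nonneg _), ← mul_assoc]
  have := abs_rpow_le (s := s) (by linarith) (a := γ * (p - 2)) (by positivity) (by linarith) η
  nlinarith

/-- Gagliardo–Nirenberg inequality combined with Young's inequality. -/
theorem exists_lintegral_norm_rpow_le (hs : 1 / 2 ≤ s) {p ε : ℝ} (hp : 2 < p)
    (hps : p < 4 * s + 2) (hε : 0 < ε) :
    ∃ C β : ℝ, 0 ≤ C ∧ 1 < β ∧ ∀ u : HSpace s, ∫⁻ x, ENNReal.ofReal (‖toL2 u x‖ ^ p) ≤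
      ENNReal.ofReal (ε * ‖fracD u‖ ^ 2 + C * (‖toL2 u‖ ^ 2) ^ β) := by
  have hp0 : 0 < p - 2 := by linarith
  -- Young exponent: `2sα = (p - 2)/2`, and `α < 1` is the subcriticality of `p`.
  set α : ℝ := (p - 2) / (4 * s) with hα
  have hα0 : 0 < α := by positivity
  have hα1 : 0 < 1 - α := by
    rw [sub_pos, hα, div_lt_one (by linarith)]; linarith
  set K : ℝ := 4 * p / (p - 2) * (2 * √2) ^ (p - 2) with hK
  have hKpos : 0 < K := by positivity
  -- Together with `θ` below, chosen so that `ε^α C^(1-α) = K` and `2θ(1-α) = p - 2`; the weight is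
  -- then exactly a weighted geometric mean.
  set C : ℝ := (K * ε ^ (-α)) ^ (1 / (1 - α)) with hC
  have hCpos : 0 < C := by positivity
  have hCα : C ^ (1 - α) = K * ε ^ (-α) := by
    rw [hC, ← Real.rpow_mul (by positivity), one_div_mul_cancel hα1.ne', Real.rpow_one]
  set θ : ℝ := (p - 2) / (2 * (1 - α)) with hθ
  have hθ0 : 0 < θ := by positivity
  refine ⟨C, 1 + θ, hCpos.le, by linarith, fun u => ?_⟩
  rcases (norm_nonneg (toL2 u)).eq_or_lt' with h0 | hm
  · have hz : ∀ᵐ x, toL2 u x = 0 := by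
      rw [norm_eq_zero] at h0
      rw [h0]
      exact Lp.coeFn_zero _ _ _
    have : ∫⁻ x, ENNReal.ofReal (‖toL2 u x‖ ^ p) = 0 := by
      rw [lintegral_eq_zero_iff' (by
        exact ((Lp.stronglyMeasurable _).measurable.norm.pow_const p).ennreal_ofReal.aemeasurable)]
      filter_upwards [hz] with x hx
      simp [hx, Real.zero_rpow (by linarith : p ≠ 0)]
    rw [this]; exact zero_le
  set m : ℝ := ‖toL2 u‖ with hmdef
  have hweight : ∫⁻ η, ENNReal.ofReal (|η| ^ (1 - 2 * (1 / 2 : ℝ))) *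
      ‖(𝓕 (toL2 u) : L2) η‖ₑ ^ 2 ≤ ENNReal.ofReal (m ^ 2) := by
    rw [← lintegral_enorm_fourier_sq]
    refine le_of_eq (lintegral_congr fun η => ?_)
    norm_num
  have hM : √(m ^ 2 / (1 / 2)) = √2 * m := by
    rw [show m ^ 2 / (1 / 2) = 2 * m ^ 2 by ring, Real.sqrt_mul (by norm_num), Real.sqrt_sq hm.le]
  -- With `γ = 1/2` the low-frequency weight is identically `1`, so only the `L²` norm enters.
  refine (lintegral_norm_rpow_le (toL2 u) (γ := 1 / 2) (M := √2 * m) (by norm_num) (by positivity)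
    hp fun A hA => ?_).trans ?_
  · rw [← hM]
    exact setLIntegral_enorm_le _ (by norm_num) (by positivity) hweight hA
  refine (lintegral_weight_le u (b := ε) (c := C * (m ^ 2) ^ θ) hε.le (by positivity)
    fun η => ?_).trans (le_of_eq ?_)
  · have hx : (0 : ℝ) ≤ |η| ^ (2 * s) := by positivity
    have hy := Real.geom_mean_le_arith_mean2_weighted hα0.le hα1.le
      (mul_nonneg hε.le hx) (by positivity : 0 ≤ C * (m ^ 2) ^ θ) (by ring)
    have hleft : 4 * p / (p - 2) * (2 * (√2 * m) * |η| ^ (1 / 2 : ℝ)) ^ (p - 2) =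
        (ε * |η| ^ (2 * s)) ^ α * (C * (m ^ 2) ^ θ) ^ (1 - α) := by
      rw [Real.mul_rpow hε.le hx, Real.mul_rpow hCpos.le (by positivity), hCα,
        ← mul_assoc 2, Real.mul_rpow (by positivity) (by positivity),
        Real.mul_rpow (by positivity) hm.le, ← Real.rpow_mul (abs_nonneg _),
        ← Real.rpow_mul (abs_nonneg _), ← Real.rpow_mul (by positivity),
        ← Real.rpow_natCast m 2, ← Real.rpow_mul hm.le, Real.rpow_neg hε.le]
      rw [show 2 * s * α = 1 / 2 * (p - 2) by rw [hα]; field_simp; ring,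
        show ((2 : ℕ) : ℝ) * (θ * (1 - α)) = p - 2 by rw [hθ]; push_cast; field_simp]
      have : ε ^ α ≠ 0 := by positivity
      rw [hK]
      field_simp
    rw [hleft]
    refine hy.trans ?_
    have hsym := abs_rpow_le_symbol_sq (s := s) (by linarith) η
    have h1 : α * (ε * |η| ^ (2 * s)) ≤ ε * symbol s η ^ 2 := by
      calc _ ≤ 1 * (ε * |η| ^ (2 * s)) := by gcongr; linarith
        _ ≤ _ := by rw [one_mul]; gcongr
    have h2 : (1 - α) * (C * (m ^ 2) ^ θ) ≤ C * (m ^ 2) ^ θ :=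
      mul_le_of_le_one_left (by positivity) (by linarith)
    linarith
  · rw [Real.rpow_add (by positivity), Real.rpow_one]
    congr 1; ring

end HSpace

/-! ### Pointwise bounds on the potential -/

section Potential

variable {F : ℝ → ℝ}

/-- Mean value inequality on `[0, r]`, where the bound on `N'` is largest at the right endpoint. -/
theorem abs_remainder_le (hF : ContDiffOn ℝ 2 F (Set.Ici 0)) (hF0 : F 0 = 0) {q₁ q₂ c : ℝ}
    (hq₁ : 2 < q₁) (hq : q₁ ≤ q₂)
    (h : ∀ r : ℝ, 0 ≤ r → |derivWithin (remainder F) (Set.Ici 0) r| ≤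
      c * (r ^ (q₁ - 1) + r ^ (q₂ - 1))) {r : ℝ} (hr : 0 ≤ r) :
    |remainder F r| ≤ c * (r ^ q₁ + r ^ q₂) := by
  have hc : 0 ≤ c := by
    have := (abs_nonneg _).trans (h 1 zero_le_one)
    norm_num at this
    linarith
  have hdiff : DifferentiableOn ℝ (remainder F) (Set.Ici 0) := by
    unfold remainder
    exact (hF.differentiableOn (by norm_num)).sub (by fun_prop)
  have hderiv : ∀ x ∈ Set.Icc 0 r,
      HasDerivWithinAt (remainder F) (derivWithin (remainder F) (Set.Ici 0) x) (Set.Icc 0 r) x :=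
    fun x hx => (hdiff x hx.1).hasDerivWithinAt.mono Set.Icc_subset_Ici_self
  have hbound : ∀ x ∈ Set.Icc 0 r, ‖derivWithin (remainder F) (Set.Ici 0) x‖ ≤
      c * (r ^ (q₁ - 1) + r ^ (q₂ - 1)) := by
    intro x hx
    refine (h x hx.1).trans ?_
    have h1 := Real.rpow_le_rpow hx.1 hx.2 (by linarith : 0 ≤ q₁ - 1)
    have h2 := Real.rpow_le_rpow hx.1 hx.2 (by linarith : 0 ≤ q₂ - 1)
    gcongr
  have := (convex_Icc 0 r).norm_image_sub_le_of_norm_hasDerivWithin_le hderiv hbound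
    (Set.left_mem_Icc.2 hr) (Set.right_mem_Icc.2 hr)
  have h0 : remainder F 0 = 0 := by simp [remainder, hF0]
  rw [h0, sub_zero, sub_zero, Real.norm_eq_abs, Real.norm_of_nonneg hr] at this
  refine this.trans (le_of_eq ?_)
  rcases hr.eq_or_lt with rfl | hr
  · rw [Real.zero_rpow (by linarith : q₁ ≠ 0), Real.zero_rpow (by linarith : q₂ ≠ 0)]
    simp
  · rw [mul_assoc, add_mul, ← Real.rpow_add_one hr.ne', ← Real.rpow_add_one hr.ne']
    simp

/-- Near `0` the quadratic term absorbs `N`, since both `q`'s exceed `2`; at infinity the hypothesis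
applies; in between `N` is bounded and `r ^ p` is bounded away from `0`. -/
theorem exists_remainder_lower_bound {q₁ q₂ c₁ p c ε : ℝ} (hq₁ : 2 < q₁) (hq : q₁ ≤ q₂)
    (h : ∀ r : ℝ, 0 ≤ r → |remainder F r| ≤ c₁ * (r ^ q₁ + r ^ q₂))
    (hc : 0 ≤ c) (hN : ∀ᶠ r : ℝ in atTop, -c * r ^ p ≤ remainder F r) (hp : 2 < p) (hε : 0 < ε) :
    ∃ C : ℝ, 0 ≤ C ∧ ∀ r : ℝ, 0 ≤ r → -ε * r ^ 2 - C * r ^ p ≤ remainder F r := by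
  have hc₁ : 0 ≤ c₁ := by
    have := (abs_nonneg _).trans (h 1 zero_le_one)
    norm_num at this
    linarith
  have hlim : Tendsto (fun r : ℝ => c₁ * (r ^ (q₁ - 2) + r ^ (q₂ - 2))) (𝓝 0) (𝓝 0) := by
    have h1 : ContinuousAt (fun r : ℝ => c₁ * (r ^ (q₁ - 2) + r ^ (q₂ - 2))) 0 :=
      (((Real.continuousAt_rpow_const _ _ (Or.inr (by linarith)))).add
        (Real.continuousAt_rpow_const _ _ (Or.inr (by linarith)))).const_mul _
    have h2 := h1.tendsto
    rwa [Real.zero_rpow (by linarith), Real.zero_rpow (by linarith), add_zero, mul_zero] at h2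
  obtain ⟨δ, hδ, hδε⟩ := Metric.eventually_nhds_iff.1 (hlim.eventually (gt_mem_nhds hε))
  obtain ⟨R, hR⟩ := eventually_atTop.1 hN
  set R' : ℝ := max R 1 with hR'
  have hR'pos : 0 < R' := lt_max_of_lt_right one_pos
  -- `c` serves `r ≥ R'`; the quotient serves `δ ≤ r ≤ R'`, where `r ^ p / δ ^ p ≥ 1`.
  refine ⟨c + c₁ * (R' ^ q₁ + R' ^ q₂) / δ ^ p, by positivity, fun r hr => ?_⟩
  have hrp : 0 ≤ r ^ p := by positivity
  have hQ : 0 ≤ c₁ * (R' ^ q₁ + R' ^ q₂) / δ ^ p * r ^ p := by positivity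
  have hcp : 0 ≤ c * r ^ p := by positivity
  have hεr : 0 ≤ ε * r ^ 2 := by positivity
  rcases lt_or_ge r δ with h1 | h1
  · have hsmall := hδε (y := r) (by rwa [Real.dist_0_eq_abs, abs_of_nonneg hr])
    have hrw : ∀ q : ℝ, 2 < q → r ^ q = r ^ (q - 2) * r ^ 2 := by
      intro q hq
      rw [← Real.rpow_natCast, ← Real.rpow_add_of_nonneg hr (by linarith) (by norm_num)]
      congr 1; push_cast; ring
    have h2 := neg_le_of_abs_le (h r hr)
    rw [hrw q₁ hq₁, hrw q₂ (by linarith), ← add_mul, ← mul_assoc] at h2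
    have h3 := mul_le_mul_of_nonneg_right hsmall.le (sq_nonneg r)
    linarith
  · rcases le_total R' r with h2 | h2
    · have := hR r ((le_max_left _ _).trans h2)
      linarith
    · have h3 := neg_le_of_abs_le (h r hr)
      have h4 : c₁ * (r ^ q₁ + r ^ q₂) ≤ c₁ * (R' ^ q₁ + R' ^ q₂) := by
        have e1 := Real.rpow_le_rpow hr h2 (by linarith : 0 ≤ q₁)
        have e2 := Real.rpow_le_rpow hr h2 (by linarith : 0 ≤ q₂)
        gcongr
      have h5 : c₁ * (R' ^ q₁ + R' ^ q₂) ≤ c₁ * (R' ^ q₁ + R' ^ q₂) / δ ^ p * r ^ p := by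
        rw [div_mul_eq_mul_div, le_div_iff₀ (by positivity)]
        have e1 := Real.rpow_le_rpow hδ.le h1 (by linarith : 0 ≤ p)
        gcongr
      linarith

end Potential

/-! ### Integrability, charge and a coercivity criterion -/

namespace HSpace

variable {s : ℝ}

theorem integrable_norm_rpow (hs : 1 / 2 ≤ s) (u : HSpace s) {p : ℝ} (hp : 2 < p) :
    Integrable (fun x => ‖toL2 u x‖ ^ p) volume := by
  refine ⟨((Lp.stronglyMeasurable _).measurable.norm.pow_const p).aestronglyMeasurable, ?_⟩
  rw [hasFiniteIntegral_iff_ofReal (.of_forall fun x => by positivity)]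
  exact lintegral_norm_rpow_lt_top hs u hp

end HSpace

theorem integrable_norm_sq (f : L2) : Integrable (fun x => ‖f x‖ ^ 2) volume :=
  (Lp.memLp f).integrable_norm_pow (p := 2) (by norm_num)

theorem integral_norm_sq (f : L2) : ∫ x, ‖f x‖ ^ 2 = ‖f‖ ^ 2 := by
  rw [integral_eq_lintegral_of_nonneg_ae (.of_forall fun x => by positivity)
    (integrable_norm_sq f).aestronglyMeasurable]
  simp_rw [ENNReal.ofReal_pow (norm_nonneg _), ofReal_norm]
  rw [lintegral_enorm_sq, ENNReal.toReal_ofReal (by positivity)]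

theorem charge_eq {s : ℝ} (u : HSpace s) : charge s u = ‖HSpace.toL2 u‖ ^ 2 :=
  integral_norm_sq _

theorem charge_pos_iff {s : ℝ} (u : HSpace s) : 0 < charge s u ↔ u ≠ 0 := by
  have hinj : Function.Injective (HSpace.toL2 (s := s)) := Subtype.val_injective
  rw [charge_eq, sq_pos_iff, norm_ne_zero_iff]
  exact not_congr (map_eq_zero_iff _ hinj)

/-- A functional bounded below by a multiple of the squared norm is coercive. -/
theorem coercivity_of_le {X : Type*} [NormedAddCommGroup X] {E C : X → ℝ} {a β k : ℝ}
    (hC : ∀ u, 0 < C u ↔ u ≠ 0) (ha : 0 ≤ a) (hβ : 1 < β) (hk : 0 < k)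
    (h : ∀ u, k * ‖u‖ ^ 2 ≤ E u + a * C u ^ β) : Coercivity E C := by
  refine ⟨hC, a, β, ha, hβ, fun u => le_trans (by positivity) (h u), ?_, ?_⟩
  · refine tendsto_atTop_mono h ?_
    exact (((tendsto_pow_atTop two_ne_zero).const_mul_atTop hk).comp tendsto_comap)
  · intro u _ hu
    have h1 : Tendsto (fun n => ‖u n‖ ^ 2) atTop (𝓝 0) := by
      refine squeeze_zero (fun n => by positivity) (fun n => ?_)
        (by simpa using hu.const_mul k⁻¹)
      rw [inv_mul_eq_div, le_div_iff₀' hk]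
      exact h (u n)
    rw [tendsto_zero_iff_norm_tendsto_zero]
    simpa [Real.sqrt_sq (norm_nonneg _)] using h1.sqrt

end FracSchrodinger

/-! ### Coercivity of the energy -/

theorem mainTheorem10
    (s : ℝ) (hs : 1 / 2 ≤ s)
    -- the potential, which depends on `|ψ|` only
    (W : ℂ → ℝ) (F : ℝ → ℝ) (hWF : ∀ z : ℂ, W z = F ‖z‖)
    (hF : ContDiffOn ℝ 2 F (Set.Ici 0))
    (hF0 : F 0 = 0) (hF0' : derivWithin F (Set.Ici 0) 0 = 0)
    -- `E₀ > 0`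
    (hE0 : 0 < FracSchrodinger.quadCoeff F)
    -- `N` is negative somewhere
    (hN1 : ∃ r₀ : ℝ, 0 < r₀ ∧ FracSchrodinger.remainder F r₀ < 0)
    -- growth of `N'`
    (hN2 : ∃ q₁ q₂ c₁ : ℝ, 2 < q₁ ∧ q₁ ≤ q₂ ∧ ∀ r : ℝ, 0 ≤ r →
      |derivWithin (FracSchrodinger.remainder F) (Set.Ici 0) r| ≤
        c₁ * (r ^ (q₁ - 1) + r ^ (q₂ - 1)))
    -- lower bound for `N` at infinity, with a subcritical exponent
    (hN3 : ∃ p c : ℝ, 2 < p ∧ p < 4 * s + 2 ∧ 0 ≤ c ∧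
      ∀ᶠ r : ℝ in atTop, -c * r ^ p ≤ FracSchrodinger.remainder F r) :
    -- the energy is a well-defined real functional on `H^s`, and coercivity holds
    (∀ ψ : FracSchrodinger.HSpace s,
      Integrable (FracSchrodinger.energyDensity s W ψ) volume) ∧
    FracSchrodinger.Coercivity (FracSchrodinger.energy s W) (FracSchrodinger.charge s) := by
  open FracSchrodinger HSpace in
  obtain ⟨q₁, q₂, c₁, hq₁, hq, hN'⟩ := hN2
  obtain ⟨p, c, hp, hps, hc, hN⟩ := hN3
  have hNabs := fun r hr => abs_remainder_le hF hF0 hq₁ hq hN' (r := r) hr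
  set E₀ := quadCoeff F with hE₀
  -- Half of `E₀` is spent on `N` near `0`; the other half controls the `L²` norm.
  obtain ⟨A, hA, hlow⟩ :=
    exists_remainder_lower_bound hq₁ hq hNabs hc hN hp (half_pos hE0)
  have hWr : ∀ z : ℂ, W z = E₀ * ‖z‖ ^ 2 + remainder F ‖z‖ := fun z => by
    rw [hWF, remainder]; ring
  have hWc : Continuous W := by
    rw [funext hWF]
    exact hF.continuousOn.comp_continuous continuous_norm fun z => norm_nonneg z
  have hWint : ∀ ψ : HSpace s, Integrable (fun x => W (toL2 ψ x)) volume := by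
    intro ψ
    refine Integrable.mono' (((integrable_norm_sq (toL2 ψ)).const_mul E₀).add
      (((integrable_norm_rpow hs ψ hq₁).add
        (integrable_norm_rpow hs ψ (hq₁.trans_le hq))).const_mul c₁))
      (hWc.comp_aestronglyMeasurable (Lp.aestronglyMeasurable _)) (.of_forall fun x => ?_)
    rw [hWr]
    refine (abs_add_le _ _).trans ?_
    rw [abs_of_nonneg (by positivity)]
    exact add_le_add le_rfl (hNabs _ (norm_nonneg _))
  have hDint : ∀ ψ : HSpace s, Integrable (fun x => (1 / 2) * ‖fracD ψ x‖ ^ 2) volume :=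
    fun ψ => (integrable_norm_sq _).const_mul _
  refine ⟨fun ψ => (hDint ψ).add (hWint ψ), ?_⟩
  -- This `ε` makes `A * ε ≤ 1/4`, so a quarter of `‖D^s ψ‖²` survives; `A + 1` avoids division by
  -- zero. The charge term is cancelled by `a = A * C`.
  obtain ⟨C, β, hC, hβ, hGN⟩ := exists_lintegral_norm_rpow_le hs hp hps
    (show (0 : ℝ) < 1 / (4 * (A + 1)) by positivity)
  refine coercivity_of_le charge_pos_iff (mul_nonneg hA hC) hβ
    (k := min (1 / 4) (E₀ / 2)) (by positivity) fun ψ => ?_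
  have hGN' : ∫ x, ‖toL2 ψ x‖ ^ p ≤
      1 / (4 * (A + 1)) * ‖fracD ψ‖ ^ 2 + C * (‖toL2 ψ‖ ^ 2) ^ β := by
    rw [integral_eq_lintegral_of_nonneg_ae (.of_forall fun x => by positivity)
      (integrable_norm_rpow hs ψ hp).aestronglyMeasurable]
    exact ENNReal.toReal_le_of_le_ofReal (by positivity) (hGN ψ)
  have hWlow : E₀ / 2 * ‖toL2 ψ‖ ^ 2 - A * ∫ x, ‖toL2 ψ x‖ ^ p ≤ ∫ x, W (toL2 ψ x) := by
    rw [← integral_norm_sq, ← integral_const_mul, ← integral_const_mul, ← integral_sub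
      ((integrable_norm_sq _).const_mul _) ((integrable_norm_rpow hs ψ hp).const_mul _)]
    refine integral_mono (((integrable_norm_sq _).const_mul _).sub
      ((integrable_norm_rpow hs ψ hp).const_mul _)) (hWint ψ) fun x => ?_
    have := hlow _ (norm_nonneg (toL2 ψ x))
    simp only [hWr]
    linarith
  have hE : energy s W ψ = 1 / 2 * ‖fracD ψ‖ ^ 2 + ∫ x, W (toL2 ψ x) := by
    rw [← integral_norm_sq, ← integral_const_mul, ← integral_add (hDint ψ) (hWint ψ)]
    rfl
  have hA4 : A * (1 / (4 * (A + 1)) * ‖fracD ψ‖ ^ 2) ≤ 1 / 4 * ‖fracD ψ‖ ^ 2 := by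
    rw [← mul_assoc]
    gcongr
    rw [mul_one_div, div_le_div_iff₀ (by positivity) (by norm_num)]
    linarith
  have hAG := mul_le_mul_of_nonneg_left hGN' hA
  have hk1 := mul_le_mul_of_nonneg_right (min_le_left (1 / 4) (E₀ / 2)) (sq_nonneg ‖fracD ψ‖)
  have hk2 := mul_le_mul_of_nonneg_right (min_le_right (1 / 4) (E₀ / 2)) (sq_nonneg ‖toL2 ψ‖)
  rw [norm_sq_eq, charge_eq, hE]
  linarith
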